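/- Let $d\ge 1$, let $\|\cdot\|$ be an arbitrary norm on $\mathbb{R}^d$, let $\rho\in(0,\infty)$, and let $g:\mathbb{R}^d\to[0,1]$ be measurable with $g(-x)=g(x)$ for all $x$ and $0<\int_{\mathbb{R}^d}g(x)\,dx<\infty$. The random connection model with intensity $\rho$ and connection function $g$ has as its vertex set a homogeneous Poisson point process $\mathcal P=\{X_n:n\in\mathbb N\}$ of intensity $\rho$ in $\mathbb{R}^d$; given the vertices, each pair of distinct vertices $x,y$ is joined by an undirected edge ($x\leftrightarrow y$) with probability $g(x-y)$, independently of all other pairs. Let $\mathbb{P}_0$ be its Palm measure at $0$, that is, the law of the model obtained by adding the point $0$ to the vertex set: the vertices are $\mathcal P\cup\{0\}$ and, given these, edges are drawn independently by the same rule. Put $e_0^*=\max_{y\in\mathcal P}\|y\|\,\mathbf 1_{\{0\leftrightarrow y\}}$ (a supremum in $[0,\infty]$, equal to $0$ if $0$ has no neighbour), and let $B_r^C(0)=\{x\in\mathbb{R}^d:\|x\|>r\}$. Then, for every $r\ge 0$, $$\mathbb{P}_0(e_0^*\le r)=\exp\Big(-\rho\int_{B_r^C(0)}g(x)\,dx\Big).$$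 In particular, for every $\varepsilon>0$ there is $R>0$, depending only on $\varepsilon,d,\|\cdot\|,\rho,g$, such that for all $r\ge R$ $$(1-\varepsilon)\,\rho\int_{B_r^C(0)}g(x)\,dx\;\le\;\mathbb{P}_0(e_0^*>r)\;\le\;\rho\int_{B_r^C(0)}g(x)\,dx .$$ -/

import Mathlib

open MeasureTheory ProbabilityTheory

namespace RCM

noncomputable section

/-- The number (with multiplicity, possibly infinite) of points of the configuration
`{X 0 ω, X 1 ω, …}` in the set `B`. -/
def count {Ω E : Type*} (X : ℕ → Ω → E) (B : Set E) (ω : Ω) : ℕ∞ :=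
  Set.encard {n : ℕ | X n ω ∈ B}

/-- The random points `X 0, X 1, …` form, under the probability measure `P`, a Poisson point
process with intensity measure `Λ`: the number of points in a set of finite `Λ`-measure is Poisson
distributed with parameter `Λ B`, and the numbers of points in finitely many pairwise disjoint sets
are independent. -/
structure IsPoissonProcess {Ω E : Type*} [MeasurableSpace Ω] [MeasurableSpace E]
    (P : Measure Ω) (Λ : Measure E) (X : ℕ → Ω → E) : Prop where
  measurable : ∀ n, Measurable (X n)
  poisson : ∀ B : Set E, MeasurableSet B → Λ B < ⊤ → ∀ k : ℕ,
    P {ω | count X B ω = k} = poissonMeasure (Λ B).toNNReal {k}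
  indep : ∀ (m : ℕ) (B : Fin m → Set E), (∀ i, MeasurableSet (B i)) →
    (∀ i j, i ≠ j → Disjoint (B i) (B j)) → iIndepFun (fun i => count X (B i)) P

/-- The σ-algebra generated by the random points `Y 0, Y 1, …`. -/
abbrev vertexSigma {Ω E : Type*} [MeasurableSpace E] (Y : ℕ → Ω → E) : MeasurableSpace Ω :=
  ⨆ i, MeasurableSpace.comap (Y i) inferInstance

/-- `G` is, under `P`, the edge set of the random connection model with vertices `Y 0, Y 1, …` and
connection function `g`: given all the vertices, distinct vertices `Y i` and `Y j` are joined with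
probability `g (Y i - Y j)`, independently for different unordered pairs of vertices. The graph is
carried by the indices of the vertices; each unordered pair is listed once, as `(i, j)` with
`i < j`. -/
structure IsRandomConnectionModel {Ω E : Type*} [MeasurableSpace Ω] [MeasurableSpace E] [Sub E]
    (P : Measure Ω) (g : E → ℝ) (Y : ℕ → Ω → E) (G : Ω → SimpleGraph ℕ) : Prop where
  measurable_vertex : ∀ i, Measurable (Y i)
  measurable_edge : ∀ i j, MeasurableSet {ω | (G ω).Adj i j}
  condProb : ∀ S : Finset (ℕ × ℕ), (∀ e ∈ S, e.1 < e.2) →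
    P[Set.indicator {ω | ∀ e ∈ S, (G ω).Adj e.1 e.2} (fun _ => (1 : ℝ)) | vertexSigma Y]
      =ᵐ[P] fun ω => ∏ e ∈ S, g (Y e.1 ω - Y e.2 ω)

/-- The points `X 0, X 1, …` with the origin added as the vertex with index `0`. -/
def addOrigin {Ω E : Type*} [Zero E] (X : ℕ → Ω → E) : ℕ → Ω → E
  | 0, _ => 0
  | n + 1, ω => X n ω

/-- `P` is the Palm measure at the origin of the random connection model in `ℝ^d` with intensity `ρ`
and connection function `g`: under `P`, the points `X` form a homogeneous Poisson process of
intensity `ρ`, and `G` is the random connection model on these points together with the origin. -/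
structure IsPalmRCM {d : ℕ} {Ω : Type*} [MeasurableSpace Ω] (P : Measure Ω) (ρ : ℝ)
    (g : (Fin d → ℝ) → ℝ) (X : ℕ → Ω → (Fin d → ℝ)) (G : Ω → SimpleGraph ℕ) : Prop where
  isProbabilityMeasure : IsProbabilityMeasure P
  poisson : IsPoissonProcess P (ENNReal.ofReal ρ • volume) X
  edges : IsRandomConnectionModel P g (addOrigin X) G

/-- `e₀* = max_y ‖y‖ 1{0 ↔ y}`, the maximum being over all vertices `y`, where the norm is `N` and
the origin is the vertex with index `0`. It is written as a supremum in `[0, ∞]`. -/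
def maxEdge {d : ℕ} {Ω : Type*} (N : Seminorm ℝ (Fin d → ℝ)) (X : ℕ → Ω → (Fin d → ℝ))
    (G : Ω → SimpleGraph ℕ) (ω : Ω) : ENNReal :=
  ⨆ n : ℕ, Set.indicator {n | (G ω).Adj 0 n} (fun n => ENNReal.ofReal (N (addOrigin X n ω))) n

end

end RCM

/-!
The longest edge at the origin has length at most `r` exactly when no point of the Poisson process
outside the closed ball of radius `r` is joined to the origin. Given the points, each point `x`
outside the ball independently fails to be joined to the origin with probability `1 - g x`, so the
probability in question is `E ∏ₙ (1 - h (X n))` with `h = g` off the ball and `h = 0` on it. Writing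
`1 - 1_A` for the indicator of the absence of an edge and expanding the product reduces this to the
conditional probabilities of finite sets of edges (`measureReal_iInter_compl_edgeInto`).

The expectation is the Laplace functional of the Poisson process, equal to `exp (-ρ ∫ h)`
(`IsPoissonProcess.lintegral_iInf_prod_one_sub`). For a simple function `h` with values `c` on sets
`B_c` the product is `∏ (1 - c) ^ count B_c`, and the counts are independent Poisson variables whose
generating function is explicit. A general `h` is an increasing limit of simple functions, along
which both sides converge monotonically; as the partial products also decrease, the two limits
are infima and may be exchanged.

The asymptotic bounds follow from `I - I ^ 2 ≤ 1 - exp (-I) ≤ I` for `I ≥ 0`, since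
`I = ρ ∫ g` over the complement of the ball tends to `0` by integrability of `g`.
-/

namespace RCM

open Filter Topology
open scoped ENNReal NNReal

/-! ### Counting variables of a Poisson process -/

/-- The number of points in `B` is at least `k` exactly when some set of `k` indices is mapped
into `B`; this exhibits `count X B` as a countable supremum of measurable functions. -/
lemma count_eq_iSup {Ω E : Type*} (X : ℕ → Ω → E) (B : Set E) (ω : Ω) :
    count X B ω =
      ⨆ t : Finset ℕ, Set.indicator {ω | ∀ n ∈ t, X n ω ∈ B} (fun _ => (t.card : ℕ∞)) ω := by
  classical
  refine le_antisymm ?_ (iSup_le fun t => ?_)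
  · refine ENat.forall_natCast_le_iff_le.1 fun k hk => ?_
    obtain ⟨t, hts, htk⟩ := Set.exists_subset_encard_eq hk
    have htf : t.Finite := Set.finite_of_encard_eq_coe htk
    refine le_iSup_of_le htf.toFinset ?_
    have hmem : ω ∈ {ω | ∀ n ∈ htf.toFinset, X n ω ∈ B} := fun n hn => hts (by simpa using hn)
    rw [Set.indicator_of_mem hmem, ← htk, ← Set.encard_coe_eq_coe_finsetCard, htf.coe_toFinset]
  · by_cases h : ω ∈ {ω | ∀ n ∈ t, X n ω ∈ B}
    · rw [Set.indicator_of_mem h, ← Set.encard_coe_eq_coe_finsetCard]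
      exact Set.encard_le_encard h
    · rw [Set.indicator_of_notMem h]
      exact zero_le

lemma measurable_count {Ω E : Type*} [MeasurableSpace Ω] [MeasurableSpace E] {X : ℕ → Ω → E}
    (hX : ∀ n, Measurable (X n)) {B : Set E} (hB : MeasurableSet B) : Measurable (count X B) := by
  have : BorelSpace ℕ∞ := ⟨borel_eq_top_of_countable.symm⟩
  rw [funext (count_eq_iSup X B)]
  refine Measurable.iSup fun t => measurable_const.indicator ?_
  have : {ω | ∀ n ∈ t, X n ω ∈ B} = ⋂ n ∈ t, X n ⁻¹' B := by ext; simp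
  rw [this]
  exact t.measurableSet_biInter fun n _ => hX n hB

/-- The probability generating function of the Poisson distribution, at `1 - c` with `c ∈ [0, 1]`. -/
lemma lintegral_one_sub_pow_poissonMeasure (r : ℝ≥0) {c : ℝ≥0∞} (hc : c ≤ 1) :
    ∫⁻ k, (1 - c) ^ k ∂poissonMeasure r = ENNReal.ofReal (Real.exp (-(c * r).toReal)) := by
  set t : ℝ := (1 - c).toReal with ht
  have ht0 : 0 ≤ t := ENNReal.toReal_nonneg
  have htc : 1 - c = ENNReal.ofReal t := (ENNReal.ofReal_toReal (by simp)).symm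
  have ht1 : t = 1 - c.toReal := by simp [ht, ENNReal.toReal_sub_of_le hc]
  have hs : HasSum (fun k : ℕ => Real.exp (-r) * r ^ k / k.factorial * t ^ k)
      (Real.exp (-r) * Real.exp (r * t)) := by
    have := (NormedSpace.expSeries_div_hasSum_exp ((r : ℝ) * t)).mul_left (Real.exp (-r))
    rw [← Real.exp_eq_exp_ℝ] at this
    convert! this using 1
    ext k
    rw [mul_pow]
    ring
  rw [poissonMeasure, lintegral_sum_measure]
  simp_rw [lintegral_smul_measure, lintegral_dirac, smul_eq_mul, htc,
    ← ENNReal.ofReal_pow ht0]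
  have : ∀ k : ℕ, 0 ≤ Real.exp (-r) * r ^ k / k.factorial := fun k => by positivity
  simp_rw [← ENNReal.ofReal_mul (this _)]
  rw [← ENNReal.ofReal_tsum_of_nonneg (fun k => by positivity) hs.summable, hs.tsum_eq,
    ← Real.exp_add, ht1, ENNReal.toReal_mul]
  congr 2
  simp
  ring

namespace IsPoissonProcess

variable {Ω E : Type*} [MeasurableSpace Ω] [MeasurableSpace E] {P : Measure Ω}
  {Λ : Measure E} {X : ℕ → Ω → E}

lemma ae_count_ne_top [IsProbabilityMeasure P] (hX : IsPoissonProcess P Λ X) {B : Set E}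
    (hB : MeasurableSet B) (hfin : Λ B < ∞) : ∀ᵐ ω ∂P, count X B ω ≠ ⊤ := by
  have hm := measurable_count hX.measurable hB
  have hU : {ω | count X B ω ≠ ⊤} = ⋃ k : ℕ, {ω | count X B ω = k} := by
    ext ω
    simp only [Set.mem_ofPred_eq, Set.mem_iUnion, ENat.ne_top_iff_exists]
    exact exists_congr fun k => eq_comm
  have hmk : ∀ k : ℕ, MeasurableSet {ω | count X B ω = k} := fun k =>
    hm (measurableSet_singleton (k : ℕ∞))
  refine (mem_ae_iff_prob_eq_one (hm (measurableSet_singleton ⊤).compl)).2 ?_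
  change P {ω | count X B ω ≠ ⊤} = 1
  rw [hU, measure_iUnion _ hmk]
  · simp_rw [hX.poisson B hB hfin]
    rw [← measure_iUnion (by simp [Pairwise]) (fun k => measurableSet_singleton k),
      Set.iUnion_of_singleton, measure_univ]
  · intro i j hij
    refine Set.disjoint_left.2 fun ω hi hj => hij ?_
    exact_mod_cast (hi.symm.trans hj : (i : ℕ∞) = j)

lemma map_toNat_count [IsProbabilityMeasure P] (hX : IsPoissonProcess P Λ X) {B : Set E}
    (hB : MeasurableSet B) (hfin : Λ B < ∞) :
    P.map (fun ω => (count X B ω).toNat) = poissonMeasure (Λ B).toNNReal := by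
  have hm : Measurable fun ω => (count X B ω).toNat :=
    Measurable.of_discrete.comp (measurable_count hX.measurable hB)
  refine Measure.ext_iff_singleton.2 fun k => ?_
  rw [Measure.map_apply hm (measurableSet_singleton k), ← hX.poisson B hB hfin k]
  refine measure_congr ?_
  filter_upwards [hX.ae_count_ne_top hB hfin] with ω hω
  refine propext ?_
  change (count X B ω).toNat = k ↔ count X B ω = k
  rw [← ENat.natCast_toNat hω]
  simp

/-- Also valid when `c = 0` and `B` has infinite measure, by the convention `0 * ∞ = 0`. -/
lemma lintegral_one_sub_pow_count [IsProbabilityMeasure P] (hX : IsPoissonProcess P Λ X) {B : Set E}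
    (hB : MeasurableSet B) {c : ℝ≥0∞} (hc : c ≤ 1) (hfin : c = 0 ∨ Λ B < ∞) :
    ∫⁻ ω, (1 - c) ^ (count X B ω).toNat ∂P
      = ENNReal.ofReal (Real.exp (-(c * Λ B).toReal)) := by
  rcases hfin with rfl | hfin
  · simp
  have hm : Measurable fun ω => (count X B ω).toNat :=
    Measurable.of_discrete.comp (measurable_count hX.measurable hB)
  rw [← lintegral_map (f := fun k : ℕ => (1 - c) ^ k) Measurable.of_discrete hm,
    hX.map_toNat_count hB hfin, lintegral_one_sub_pow_poissonMeasure _ hc,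
    ENNReal.coe_toNNReal hfin.ne]

end IsPoissonProcess

/-! ### The Laplace functional of a Poisson process -/

lemma antitone_prod_range_one_sub (u : ℕ → ℝ≥0∞) :
    Antitone fun m => ∏ n ∈ Finset.range m, (1 - u n) := fun _ _ h =>
  Finset.prod_le_prod_of_subset_of_le_one' (Finset.range_mono h) fun _ _ _ => tsub_le_self

namespace IsPoissonProcess

variable {Ω E : Type*} [MeasurableSpace Ω] [MeasurableSpace E] {P : Measure Ω}
  {Λ : Measure E} {X : ℕ → Ω → E}

/-- Almost surely a simple function of finite integral is nonzero at finitely many points of the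
process only, so that the infinite product stabilises and can be sorted by the values `c` of the
function. -/
lemma ae_iInf_prod_simpleFunc [IsProbabilityMeasure P] (hX : IsPoissonProcess P Λ X)
    (f : SimpleFunc E ℝ≥0∞) (hfin : ∀ c ∈ f.range, c = 0 ∨ Λ (f ⁻¹' {c}) < ∞) :
    ∀ᵐ ω ∂P, ⨅ m, ∏ n ∈ Finset.range m, (1 - f (X n ω))
      = ∏ c ∈ f.range, (1 - c) ^ (count X (f ⁻¹' {c}) ω).toNat := by
  classical
  have hae : ∀ᵐ ω ∂P, ∀ c ∈ f.range, c = 0 ∨ count X (f ⁻¹' {c}) ω ≠ ⊤ := by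
    refine (Finset.eventually_all _).2 fun c hc => ?_
    rcases hfin c hc with h | h
    · exact ae_of_all _ fun _ => Or.inl h
    · filter_upwards [hX.ae_count_ne_top (f.measurableSet_fiber c) h] with ω hω
      exact Or.inr hω
  filter_upwards [hae] with ω hω
  have hsort : ∀ m, ∏ n ∈ Finset.range m, (1 - f (X n ω)) =
      ∏ c ∈ f.range, (1 - c) ^ ((Finset.range m).filter fun n => f (X n ω) = c).card := by
    intro m
    rw [← Finset.prod_fiberwise_of_maps_to' (t := f.range) (g := fun n => f (X n ω))
      (fun n _ => f.mem_range_self _) (fun c => 1 - c)]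
    simp_rw [Finset.prod_const]
  refine tendsto_nhds_unique (tendsto_atTop_iInf (antitone_prod_range_one_sub _)) ?_
  refine tendsto_const_nhds.congr' ?_
  have hev : ∀ c ∈ f.range, ∀ᶠ m in atTop, (1 - c) ^ (count X (f ⁻¹' {c}) ω).toNat =
      (1 - c) ^ ((Finset.range m).filter fun n => f (X n ω) = c).card := by
    intro c hc
    rcases hω c hc with rfl | h
    · simp
    have hf : {n : ℕ | X n ω ∈ f ⁻¹' {c}}.Finite := Set.encard_ne_top_iff.1 h
    obtain ⟨M, hM⟩ := hf.bddAbove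
    filter_upwards [eventually_gt_atTop M] with m hm
    congr 1
    rw [count, hf.encard_eq_coe_toFinset_card, ENat.toNat_natCast]
    congr 1
    ext n
    simp only [Set.Finite.mem_toFinset, Set.mem_ofPred_eq, Set.mem_preimage, Set.mem_singleton_iff,
      Finset.mem_filter, Finset.mem_range]
    exact ⟨fun hn => ⟨(hM hn).trans_lt hm, hn⟩, fun hn => hn.2⟩
  filter_upwards [(Finset.eventually_all _).2 hev] with m hm
  rw [hsort]
  exact Finset.prod_congr rfl hm

lemma lintegral_iInf_prod_simpleFunc [IsProbabilityMeasure P] (hX : IsPoissonProcess P Λ X)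
    (f : SimpleFunc E ℝ≥0∞) (hf1 : ∀ x, f x ≤ 1) (hint : ∫⁻ x, f x ∂Λ ≠ ∞) :
    ∫⁻ ω, ⨅ m, ∏ n ∈ Finset.range m, (1 - f (X n ω)) ∂P
      = ENNReal.ofReal (Real.exp (-(∫⁻ x, f x ∂Λ).toReal)) := by
  classical
  rw [SimpleFunc.lintegral_eq_lintegral, SimpleFunc.lintegral] at *
  have hterm : ∀ c ∈ f.range, c * Λ (f ⁻¹' {c}) ≠ ∞ := ENNReal.sum_ne_top.1 hint
  have hfin : ∀ c ∈ f.range, c = 0 ∨ Λ (f ⁻¹' {c}) < ∞ := by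
    intro c hc
    refine or_iff_not_imp_left.2 fun h0 => lt_top_iff_ne_top.2 fun htop => hterm c hc ?_
    rw [htop, ENNReal.mul_top h0]
  have hle : ∀ c ∈ f.range, c ≤ 1 := by
    intro c hc
    obtain ⟨x, rfl⟩ := SimpleFunc.mem_range.1 hc
    exact hf1 x
  have hind : iIndepFun (fun c : f.range => count X (f ⁻¹' {(c : ℝ≥0∞)})) P := by
    let e := f.range.equivFin
    have := hX.indep _ (fun i => f ⁻¹' {(e.symm i : ℝ≥0∞)}) (fun i => f.measurableSet_fiber _)
      (fun i j hij => Disjoint.preimage _ (by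
        simpa [Subtype.ext_iff.symm] using fun h => hij (e.symm.injective (Subtype.ext h))))
    have := this.precomp e.injective
    simpa using this
  have hpow : iIndepFun (fun (c : f.range) ω =>
      (1 - (c : ℝ≥0∞)) ^ (count X (f ⁻¹' {(c : ℝ≥0∞)}) ω).toNat) P :=
    hind.comp (fun c k => (1 - (c : ℝ≥0∞)) ^ k.toNat) fun _ => Measurable.of_discrete
  rw [lintegral_congr_ae (hX.ae_iInf_prod_simpleFunc f hfin)]
  have := lintegral_prod_eq_prod_lintegral_of_indepFun Finset.univ _ hpow fun c =>
    (Measurable.of_discrete (f := fun k : ℕ∞ => (1 - (c : ℝ≥0∞)) ^ k.toNat)).comp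
      (measurable_count hX.measurable (f.measurableSet_fiber _))
  simp_rw [← Finset.prod_coe_sort f.range]
  rw [this]
  simp_rw [fun c : f.range => hX.lintegral_one_sub_pow_count (f.measurableSet_fiber c) (hle c c.2)
    (hfin c c.2)]
  rw [ENNReal.toReal_sum hterm, ← Finset.sum_neg_distrib, Real.exp_sum,
    ENNReal.ofReal_prod_of_nonneg (fun _ _ => (Real.exp_pos _).le), ← Finset.prod_coe_sort f.range]

/-- The Laplace functional of a Poisson process: `E ∏ₙ (1 - h (X n)) = exp (-∫ h dΛ)` for measurable
`h` with values in `[0, 1]` and finite integral. The infinite product is the infimum of the finite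
ones. -/
theorem lintegral_iInf_prod_one_sub [IsProbabilityMeasure P] (hX : IsPoissonProcess P Λ X)
    {h : E → ℝ≥0∞} (hm : Measurable h) (h1 : ∀ x, h x ≤ 1) (hint : ∫⁻ x, h x ∂Λ ≠ ∞) :
    ∫⁻ ω, ⨅ m, ∏ n ∈ Finset.range m, (1 - h (X n ω)) ∂P
      = ENNReal.ofReal (Real.exp (-(∫⁻ x, h x ∂Λ).toReal)) := by
  set f := SimpleFunc.eapprox h
  have hfh : ∀ k x, f k x ≤ h x := fun k x =>
    (le_iSup (fun k => f k x) k).trans (SimpleFunc.iSup_eapprox_apply hm x).le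
  have hmono : ∀ x, Monotone fun k => f k x := fun x _ _ hij => SimpleFunc.monotone_eapprox h hij x
  have hprod : ∀ ω m, Antitone fun k => ∏ n ∈ Finset.range m, (1 - f k (X n ω)) :=
    fun ω m i j hij => Finset.prod_le_prod' fun n _ => tsub_le_tsub_left (hmono _ hij) 1
  have hanti : ∀ ω, Antitone fun k => ⨅ m, ∏ n ∈ Finset.range m, (1 - f k (X n ω)) :=
    fun ω i j hij => iInf_mono fun m => hprod ω m hij
  have hlim : ∀ ω, ⨅ k, ⨅ m, ∏ n ∈ Finset.range m, (1 - f k (X n ω))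
      = ⨅ m, ∏ n ∈ Finset.range m, (1 - h (X n ω)) := by
    intro ω
    rw [iInf_comm]
    refine iInf_congr fun m => ?_
    refine tendsto_nhds_unique (tendsto_atTop_iInf (hprod ω m)) ?_
    exact ENNReal.tendsto_finsetProd_of_ne_top _
      (fun n _ => ENNReal.Tendsto.sub tendsto_const_nhds (SimpleFunc.tendsto_eapprox hm _)
        (Or.inl ENNReal.one_ne_top)) (fun n _ => by simp)
  have hmeas : ∀ k, Measurable fun ω => ⨅ m, ∏ n ∈ Finset.range m, (1 - f k (X n ω)) :=
    fun k => Measurable.iInf fun m => Finset.measurable_fun_prod _ fun n _ =>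
      measurable_const.sub ((f k).measurable.comp (hX.measurable n))
  have hleft := lintegral_tendsto_of_tendsto_of_antitone (μ := P) (fun k => (hmeas k).aemeasurable)
    (ae_of_all _ hanti) (by
      refine ne_top_of_le_ne_top (b := ∫⁻ _, 1 ∂P) (by simp) (lintegral_mono fun ω => ?_)
      exact (iInf_le _ 0).trans (by simp))
    (ae_of_all _ fun ω => (hlim ω) ▸ tendsto_atTop_iInf (hanti ω))
  have hfint : ∀ k, ∫⁻ x, f k x ∂Λ ≠ ∞ := fun k =>
    ne_top_of_le_ne_top hint (lintegral_mono (hfh k))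
  have hsimple := fun k => hX.lintegral_iInf_prod_simpleFunc (f k)
    (fun x => (hfh k x).trans (h1 x)) (hfint k)
  simp_rw [hsimple] at hleft
  have hΛ := lintegral_tendsto_of_tendsto_of_monotone (μ := Λ)
    (fun k => (f k).measurable.aemeasurable) (ae_of_all _ hmono)
    (ae_of_all _ fun x => SimpleFunc.tendsto_eapprox hm x)
  refine tendsto_nhds_unique hleft ?_
  exact ENNReal.tendsto_ofReal
    ((Real.continuous_exp.tendsto _).comp (((ENNReal.tendsto_toReal hint).comp hΛ).neg))

end IsPoissonProcess

/-! ### Edges at the origin -/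

section Edges

variable {d : ℕ} {Ω : Type*} [MeasurableSpace Ω] {P : Measure Ω} {ρ : ℝ}
  {g : (Fin d → ℝ) → ℝ} {X : ℕ → Ω → (Fin d → ℝ)} {G : Ω → SimpleGraph ℕ}

/-- The event that the origin is joined to the `n`-th point of the Poisson process and that this
point lies in `D`. -/
def edgeInto (X : ℕ → Ω → (Fin d → ℝ)) (G : Ω → SimpleGraph ℕ) (D : Set (Fin d → ℝ)) (n : ℕ) :
    Set Ω :=
  {ω | (G ω).Adj 0 (n + 1) ∧ X n ω ∈ D}

lemma measurableSet_edgeInto (hG : IsRandomConnectionModel P g (addOrigin X) G)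
    {D : Set (Fin d → ℝ)} (hD : MeasurableSet D) (n : ℕ) : MeasurableSet (edgeInto X G D n) :=
  (hG.measurable_edge 0 (n + 1)).inter (hG.measurable_vertex (n + 1) hD)

lemma indicator_mem_unitInterval (hg_mem : ∀ x, g x ∈ Set.Icc (0 : ℝ) 1) (D : Set (Fin d → ℝ))
    (x : Fin d → ℝ) : D.indicator g x ∈ Set.Icc (0 : ℝ) 1 := by
  by_cases hx : x ∈ D
  · rw [Set.indicator_of_mem hx]
    exact hg_mem x
  · rw [Set.indicator_of_notMem hx]
    simp

/-- Integrating the conditional edge probabilities over the event, known from the vertices, that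
`X n ∈ D` for all `n ∈ T`. -/
lemma integral_prod_indicator_edgeInto [IsProbabilityMeasure P]
    (hG : IsRandomConnectionModel P g (addOrigin X) G) (hg_symm : ∀ x, g (-x) = g x)
    {D : Set (Fin d → ℝ)} (hD : MeasurableSet D) (T : Finset ℕ) :
    ∫ ω, ∏ n ∈ T, (edgeInto X G D n).indicator (fun _ => (1 : ℝ)) ω ∂P
      = ∫ ω, ∏ n ∈ T, D.indicator g (X n ω) ∂P := by
  classical
  set S : Finset (ℕ × ℕ) := T.image fun n => (0, n + 1) with hS
  set V : Set Ω := {ω | ∀ n ∈ T, X n ω ∈ D} with hV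
  set A : Set Ω := {ω | ∀ e ∈ S, (G ω).Adj e.1 e.2} with hA
  have hσ : vertexSigma (addOrigin X) ≤ ‹MeasurableSpace Ω› :=
    iSup_le fun i => (hG.measurable_vertex i).comap_le
  have hVσ : MeasurableSet[vertexSigma (addOrigin X)] V := by
    have hVeq : V = ⋂ n ∈ T, addOrigin X (n + 1) ⁻¹' D := by ext; simp [hV, addOrigin]
    rw [hVeq]
    exact T.measurableSet_biInter fun n _ =>
      le_iSup (fun i => MeasurableSpace.comap (addOrigin X i) inferInstance) (n + 1) _ ⟨D, hD, rfl⟩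
  have hAm : MeasurableSet A := by
    have hAeq : A = ⋂ e ∈ S, {ω | (G ω).Adj e.1 e.2} := by ext; simp [hA]
    rw [hAeq]
    exact S.measurableSet_biInter fun e _ => hG.measurable_edge e.1 e.2
  have hcond := hG.condProb S (by simp [hS])
  have hleft : ∀ ω, ∏ n ∈ T, (edgeInto X G D n).indicator (fun _ => (1 : ℝ)) ω
      = V.indicator (A.indicator fun _ => (1 : ℝ)) ω := by
    intro ω
    simp only [Set.indicator_apply, Finset.prod_ite_zero, Finset.prod_const_one]
    rw [← ite_and]
    refine if_congr ?_ rfl rfl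
    simp only [hV, hA, hS, edgeInto, Finset.forall_mem_image, Set.mem_ofPred_eq]
    exact ⟨fun h => ⟨fun n hn => (h n hn).2, fun n hn => (h n hn).1⟩,
      fun h n hn => ⟨h.2 hn, h.1 n hn⟩⟩
  have hright : ∀ ω, ∏ n ∈ T, D.indicator g (X n ω)
      = V.indicator (fun ω => ∏ e ∈ S, g (addOrigin X e.1 ω - addOrigin X e.2 ω)) ω := by
    intro ω
    simp only [Set.indicator_apply, Finset.prod_ite_zero, hV, Set.mem_ofPred_eq]
    congr 1
    rw [hS, Finset.prod_image (by simp)]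
    exact Finset.prod_congr rfl fun n _ => by simp [addOrigin, hg_symm]
  simp_rw [hleft, hright]
  rw [integral_indicator (hσ _ hVσ), integral_indicator (hσ _ hVσ),
    ← setIntegral_condExp hσ ((integrable_const _).indicator hAm) hVσ]
  exact integral_congr_ae (ae_restrict_of_ae hcond)

/-- Inclusion–exclusion turns the joint conditional edge probabilities into the probability that
none of the first `m` points is joined to the origin through `D`. -/
lemma measureReal_iInter_compl_edgeInto [IsProbabilityMeasure P]
    (hG : IsRandomConnectionModel P g (addOrigin X) G) (hg_meas : Measurable g)
    (hg_mem : ∀ x, g x ∈ Set.Icc (0 : ℝ) 1) (hg_symm : ∀ x, g (-x) = g x)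
    {D : Set (Fin d → ℝ)} (hD : MeasurableSet D) (s : Finset ℕ) :
    P.real (⋂ n ∈ s, (edgeInto X G D n)ᶜ) = ∫ ω, ∏ n ∈ s, (1 - D.indicator g (X n ω)) ∂P := by
  classical
  have hm := measurableSet_edgeInto hG hD
  have hXm : ∀ n, Measurable (X n) := fun n => hG.measurable_vertex (n + 1)
  have hh := indicator_mem_unitInterval hg_mem D
  have hexp : ∀ u : ℕ → ℝ, ∏ n ∈ s, (1 - u n)
      = ∑ T ∈ s.powerset, (-1) ^ T.card * ∏ n ∈ T, u n := by
    intro u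
    simp_rw [sub_eq_add_neg, Finset.prod_one_add, Finset.prod_neg]
  have hind : ∀ ω, (⋂ n ∈ s, (edgeInto X G D n)ᶜ).indicator (fun _ => (1 : ℝ)) ω
      = ∏ n ∈ s, (1 - (edgeInto X G D n).indicator (fun _ => (1 : ℝ)) ω) := by
    intro ω
    have : ∀ n, 1 - (edgeInto X G D n).indicator (fun _ => (1 : ℝ)) ω
        = if ω ∈ (edgeInto X G D n)ᶜ then 1 else 0 := by
      intro n
      by_cases h : ω ∈ edgeInto X G D n <;> simp [h]
    rw [Finset.prod_congr rfl fun n _ => this n]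
    simp only [Finset.prod_ite_zero, Finset.prod_const_one, Set.indicator_apply, Set.mem_iInter]
  rw [← integral_indicator_one (Finset.measurableSet_biInter s fun n _ => (hm n).compl)]
  change ∫ ω, (⋂ n ∈ s, (edgeInto X G D n)ᶜ).indicator (fun _ => (1 : ℝ)) ω ∂P = _
  simp_rw [hind, hexp]
  rw [integral_finsetSum, integral_finsetSum]
  · simp_rw [integral_const_mul, integral_prod_indicator_edgeInto hG hg_symm hD]
  · refine fun T _ => Integrable.const_mul (Integrable.of_mem_Icc 0 1 ?_ (ae_of_all _ fun ω => ?_)) _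
    · exact (Finset.measurable_fun_prod _ fun n _ =>
        (hg_meas.indicator hD).comp (hXm n)).aemeasurable
    · exact ⟨Finset.prod_nonneg fun n _ => (hh _).1,
        Finset.prod_le_one (fun n _ => (hh _).1) fun n _ => (hh _).2⟩
  · refine fun T _ => Integrable.const_mul (Integrable.of_mem_Icc 0 1 ?_ (ae_of_all _ fun ω => ?_)) _
    · exact (Finset.measurable_fun_prod _ fun n _ =>
        measurable_const.indicator (hm n)).aemeasurable
    · have h0 : ∀ n, 0 ≤ (edgeInto X G D n).indicator (fun _ => (1 : ℝ)) ω := fun n =>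
        Set.indicator_nonneg (fun _ _ => zero_le_one) _
      exact ⟨Finset.prod_nonneg fun n _ => h0 n, Finset.prod_le_one (fun n _ => h0 n)
        fun n _ => Set.indicator_le_self' (fun _ _ => zero_le_one) _⟩

/-- The neighbours of the origin in `D` form a thinned Poisson process; this is its void
probability. -/
theorem measureReal_iInter_compl_edgeInto_eq_exp (h : IsPalmRCM P ρ g X G) (hρ : 0 ≤ ρ)
    (hg_meas : Measurable g) (hg_mem : ∀ x, g x ∈ Set.Icc (0 : ℝ) 1)
    (hg_symm : ∀ x, g (-x) = g x) (hg_int : Integrable g)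
    {D : Set (Fin d → ℝ)} (hD : MeasurableSet D) :
    P.real (⋂ n, (edgeInto X G D n)ᶜ) = Real.exp (-(ρ * ∫ x in D, g x)) := by
  have := h.isProbabilityMeasure
  have hG := h.edges
  have hm := measurableSet_edgeInto hG hD
  have hXm := h.poisson.measurable
  have hh := indicator_mem_unitInterval hg_mem D
  have hhm : Measurable (D.indicator g) := hg_meas.indicator hD
  set u : (Fin d → ℝ) → ℝ≥0∞ := fun x => ENNReal.ofReal (D.indicator g x)
  have hum : Measurable u := hhm.ennreal_ofReal
  have huint : ∫⁻ x, u x ∂(ENNReal.ofReal ρ • volume)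
      = ENNReal.ofReal (ρ * ∫ x in D, g x) := by
    rw [lintegral_smul_measure, smul_eq_mul, ENNReal.ofReal_mul hρ, ← integral_indicator hD,
      ofReal_integral_eq_lintegral_ofReal (hg_int.indicator hD) (ae_of_all _ fun x => (hh x).1)]
  have hfinite : ∀ m, P (⋂ n ∈ Finset.range m, (edgeInto X G D n)ᶜ)
      = ∫⁻ ω, ∏ n ∈ Finset.range m, (1 - u (X n ω)) ∂P := by
    intro m
    have h01 : ∀ ω, 0 ≤ ∏ n ∈ Finset.range m, (1 - D.indicator g (X n ω)) := fun ω =>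
      Finset.prod_nonneg fun n _ => sub_nonneg.2 (hh _).2
    rw [← ofReal_measureReal,
      measureReal_iInter_compl_edgeInto hG hg_meas hg_mem hg_symm hD,
      ofReal_integral_eq_lintegral_ofReal _ (ae_of_all _ h01)]
    · refine lintegral_congr fun ω => ?_
      rw [ENNReal.ofReal_prod_of_nonneg fun n _ => sub_nonneg.2 (hh _).2]
      refine Finset.prod_congr rfl fun n _ => ?_
      rw [ENNReal.ofReal_sub _ (hh _).1, ENNReal.ofReal_one]
    · refine Integrable.of_mem_Icc 0 1 ?_ (ae_of_all _ fun ω => ⟨h01 ω, ?_⟩)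
      · exact (Finset.measurable_fun_prod _ fun n _ =>
          measurable_const.sub (hhm.comp (hXm n))).aemeasurable
      · exact Finset.prod_le_one (fun n _ => sub_nonneg.2 (hh _).2)
          fun n _ => sub_le_self _ (hh _).1
  have hinter : (⋂ n, (edgeInto X G D n)ᶜ)
      = ⋂ m, ⋂ n ∈ Finset.range m, (edgeInto X G D n)ᶜ := by
    ext ω
    simp only [Set.mem_iInter, Finset.mem_range]
    exact ⟨fun h _ n _ => h n, fun h n => h (n + 1) n n.lt_succ_self⟩
  have hanti : Antitone fun m => ⋂ n ∈ Finset.range m, (edgeInto X G D n)ᶜ := fun i j hij =>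
    Set.biInter_subset_biInter_left fun n hn => Finset.range_mono hij hn
  have hlap := h.poisson.lintegral_iInf_prod_one_sub hum
    (fun x => ENNReal.ofReal_le_one.2 (hh x).2) (huint ▸ ENNReal.ofReal_ne_top)
  rw [lintegral_iInf (f := fun m ω => ∏ n ∈ Finset.range m, (1 - u (X n ω)))
      (fun m => Finset.measurable_fun_prod _ fun n _ =>
      measurable_const.sub (hum.comp (hXm n)))
      (fun i j hij ω => antitone_prod_range_one_sub _ hij) (by simp), huint,
    ENNReal.toReal_ofReal (mul_nonneg hρ (integral_nonneg fun x => (hg_mem x).1))] at hlap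
  rw [measureReal_def, hinter, hanti.measure_iInter
    (fun m => (Finset.measurableSet_biInter _ fun n _ => (hm n).compl).nullMeasurableSet)
    ⟨0, measure_ne_top _ _⟩]
  simp_rw [hfinite]
  rw [hlap, ENNReal.toReal_ofReal (Real.exp_pos _).le]

end Edges

/-! ### The longest edge at the origin -/

/-- Index `0` contributes nothing to the supremum, a simple graph having no loops. -/
lemma setOf_maxEdge_le {d : ℕ} {Ω : Type*} (N : Seminorm ℝ (Fin d → ℝ))
    (X : ℕ → Ω → (Fin d → ℝ)) (G : Ω → SimpleGraph ℕ) {r : ℝ} (hr : 0 ≤ r) :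
    {ω | maxEdge N X G ω ≤ ENNReal.ofReal r}
      = ⋂ n, (edgeInto X G (N.closedBall 0 r)ᶜ n)ᶜ := by
  ext ω
  simp only [maxEdge, Set.mem_ofPred_eq, iSup_le_iff, Set.mem_iInter, Set.mem_compl_iff, edgeInto,
    Seminorm.mem_closedBall, sub_zero, not_and, not_not]
  constructor
  · intro h n hadj
    have := h (n + 1)
    rw [Set.indicator_of_mem (show n + 1 ∈ {n | (G ω).Adj 0 n} from hadj)] at this
    exact (ENNReal.ofReal_le_ofReal_iff hr).1 this
  · intro h n
    by_cases hadj : n ∈ {n | (G ω).Adj 0 n}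
    · rw [Set.indicator_of_mem hadj]
      cases n with
      | zero => exact absurd hadj (G ω).irrefl
      | succ n => exact ENNReal.ofReal_le_ofReal (h n hadj)
    · rw [Set.indicator_of_notMem hadj]
      exact zero_le

/-- A seminorm on a finite-dimensional space is continuous, being convex. -/
lemma measurableSet_closedBall_seminorm {d : ℕ} (N : Seminorm ℝ (Fin d → ℝ)) (r : ℝ) :
    MeasurableSet (N.closedBall 0 r) := by
  have hc : Continuous N := continuousOn_univ.1 (N.convexOn.continuousOn isOpen_univ)
  rw [Seminorm.closedBall_zero_eq]
  exact (isClosed_le hc continuous_const).measurableSet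

lemma tendsto_setIntegral_compl_closedBall {d : ℕ} (N : Seminorm ℝ (Fin d → ℝ))
    {g : (Fin d → ℝ) → ℝ} (hg_int : Integrable g) :
    Tendsto (fun r : ℝ => ∫ x in (N.closedBall 0 r)ᶜ, g x) atTop (𝓝 0) := by
  have h := tendsto_setIntegral_of_antitone (μ := volume) (f := g)
    (s := fun r : ℝ => (N.closedBall 0 r)ᶜ)
    (fun r => (measurableSet_closedBall_seminorm N r).compl)
    (fun r r' hr => Set.compl_subset_compl.2 (Seminorm.closedBall_mono hr))
    ⟨0, hg_int.integrableOn⟩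
  have hempty : ⋂ r : ℝ, (N.closedBall 0 r)ᶜ = ∅ := by
    refine Set.eq_empty_of_forall_notMem fun x hx => ?_
    exact Set.mem_iInter.1 hx (N x) (by simp [Seminorm.mem_closedBall])
  rwa [hempty, Measure.restrict_empty, integral_zero_measure] at h

end RCM

theorem mainTheorem7 {d : ℕ} (hd : 0 < d)
    (N : Seminorm ℝ (Fin d → ℝ)) (hN : ∀ x, N x = 0 → x = 0)
    (ρ : ℝ) (hρ : 0 < ρ)
    (g : (Fin d → ℝ) → ℝ) (hg_meas : Measurable g) (hg_mem : ∀ x, g x ∈ Set.Icc (0 : ℝ) 1)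
    (hg_symm : ∀ x, g (-x) = g x) (hg_int : Integrable g) (hg_pos : 0 < ∫ x, g x) :
    (∀ (Ω : Type*) [MeasurableSpace Ω] (P₀ : Measure Ω) (X : ℕ → Ω → (Fin d → ℝ))
        (G : Ω → SimpleGraph ℕ), RCM.IsPalmRCM P₀ ρ g X G →
      ∀ r : ℝ, 0 ≤ r →
        P₀.real {ω | RCM.maxEdge N X G ω ≤ ENNReal.ofReal r}
          = Real.exp (-(ρ * ∫ x in (N.closedBall 0 r)ᶜ, g x))) ∧
    (∀ ε : ℝ, 0 < ε → ∃ R : ℝ, 0 < R ∧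
      ∀ (Ω : Type*) [MeasurableSpace Ω] (P₀ : Measure Ω) (X : ℕ → Ω → (Fin d → ℝ))
        (G : Ω → SimpleGraph ℕ), RCM.IsPalmRCM P₀ ρ g X G →
      ∀ r : ℝ, R ≤ r →
        (1 - ε) * (ρ * ∫ x in (N.closedBall 0 r)ᶜ, g x)
            ≤ P₀.real {ω | ENNReal.ofReal r < RCM.maxEdge N X G ω} ∧
          P₀.real {ω | ENNReal.ofReal r < RCM.maxEdge N X G ω}
            ≤ ρ * ∫ x in (N.closedBall 0 r)ᶜ, g x) := by
  have hball : ∀ r : ℝ, MeasurableSet (N.closedBall 0 r)ᶜ := fun r =>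
    (RCM.measurableSet_closedBall_seminorm N r).compl
  refine ⟨fun Ω _ P₀ X G h r hr => ?_, fun ε hε => ?_⟩
  · rw [RCM.setOf_maxEdge_le N X G hr]
    exact RCM.measureReal_iInter_compl_edgeInto_eq_exp h hρ.le hg_meas hg_mem hg_symm hg_int
      (hball r)
  have hlim : Filter.Tendsto (fun r : ℝ => ρ * ∫ x in (N.closedBall 0 r)ᶜ, g x) Filter.atTop
      (nhds 0) := by
    simpa using (RCM.tendsto_setIntegral_compl_closedBall N hg_int).const_mul ρ
  obtain ⟨R, hR⟩ := Filter.eventually_atTop.1 (hlim.eventually_lt_const hε)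
  refine ⟨max R 1, by positivity, fun Ω _ P₀ X G h r hr => ?_⟩
  have hr0 : 0 ≤ r := zero_le_one.trans ((le_max_right R 1).trans hr)
  have hIε := hR r ((le_max_left R 1).trans hr)
  have hI0 : 0 ≤ ρ * ∫ x in (N.closedBall 0 r)ᶜ, g x :=
    mul_nonneg hρ.le (integral_nonneg fun x => (hg_mem x).1)
  have hprob : P₀.real {ω | ENNReal.ofReal r < RCM.maxEdge N X G ω}
      = 1 - Real.exp (-(ρ * ∫ x in (N.closedBall 0 r)ᶜ, g x)) := by
    have := h.isProbabilityMeasure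
    have hcompl : {ω | ENNReal.ofReal r < RCM.maxEdge N X G ω}
        = {ω | RCM.maxEdge N X G ω ≤ ENNReal.ofReal r}ᶜ := by
      ext ω
      simp
    rw [hcompl, RCM.setOf_maxEdge_le N X G hr0, probReal_compl_eq_one_sub
      (MeasurableSet.iInter fun n => (RCM.measurableSet_edgeInto h.edges (hball r) n).compl),
      RCM.measureReal_iInter_compl_edgeInto_eq_exp h hρ.le hg_meas hg_mem hg_symm hg_int (hball r)]
  rw [hprob]
  generalize ρ * ∫ x in (N.closedBall 0 r)ᶜ, g x = I at hIε hI0 ⊢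
  have hle : 1 - Real.exp (-I) ≤ I := by linarith [Real.add_one_le_exp (-I)]
  refine ⟨?_, hle⟩
  -- With `p = 1 - exp (-I) ≤ I`, the bound `(1 - p) (1 + I) ≤ 1` gives `p ≥ I - p I ≥ (1 - I) I`.
  have hexp : Real.exp (-I) * (1 + I) ≤ 1 := by
    have := mul_le_mul_of_nonneg_left (Real.add_one_le_exp I) (Real.exp_pos (-I)).le
    rw [← Real.exp_add, neg_add_cancel, Real.exp_zero] at this
    linarith
  nlinarith [mul_nonneg hI0 (sub_nonneg.2 hle), mul_nonneg hI0 (sub_nonneg.2 hIε.le)]
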